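/- **Setting.** Let $(\Omega,\mathcal A,\mathbb P,\mathbb D,\Gamma)$ be an error structure, i.e. a probability space with a local Dirichlet form admitting a square field operator: $\mathbb D$ is a dense subspace of $L^2(\mathbb P)$; $\Gamma:\mathbb D\times\mathbb D\to L^1(\mathbb P)$ is bilinear, symmetric and positive ($\Gamma[u]:=\Gamma[u,u]\ge 0$); for $u\in\mathbb D^m$, $v\in\mathbb D^n$ and Lipschitz $C^1$ functions $F:\mathbb R^m\to\mathbb R$, $H:\mathbb R^n\to\mathbb R$ one has $F(u),H(v)\in\mathbb D$ and $\Gamma[F(u),H(v)]=\sum_{i,j}\partial_iF(u)\,\partial_jH(v)\,\Gamma[u_i,v_j]$ a.s.; and the form $\mathcal E[u,v]=\frac12\mathbb E\,\Gamma[u,v]$ is closed, i.e. $\mathbb D$ is complete for the norm $(\|u\|_{L^2}^2+\mathcal E[u,u])^{1/2}$. Its generator $(A,\mathcal DA)$ is defined by: $u\in\mathcal DA$ and $A[u]=a$ iff $u\in\mathbb D$, $a\in L^2(\mathbb P)$ and $\mathcal E[u,v]=-\langle a,v\rangle_{L^2(\mathbb P)}$ for all $v\in\mathbb D$. Put $\operatorname{sign}(y)=y/|y|$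 for $y\neq0$ and $\operatorname{sign}(0)=0$. **Proposition 5.** Let $X$ be a real random variable with $X\in\mathcal DA$, $\Gamma[X]\in\mathbb D$ and $\Gamma[X]>0$ a.s., and let $G\in\mathbb D\cap L^\infty$. Then the law of $X$ has a density with respect to Lebesgue measure. Let $f$ be any version of this density and let $x\mapsto\mathbb E[G\mid X=x]$ be any version of the conditional expectation. a) For every $\varepsilon>0$, $\frac{G}{\varepsilon+\Gamma[X]}\in\mathbb D$ and $\Gamma\big[X,\frac{G}{\varepsilon+\Gamma[X]}\big]+\frac{2G\,A[X]}{\varepsilon+\Gamma[X]}$ is integrable. For Lebesgue-almost every $x\in\mathbb R$, $$f(x)\,\mathbb E[G\mid X=x]=\lim_{\varepsilon\downarrow0}\frac12\,\mathbb E\Big(\operatorname{sign}(x-X)\Big(\Gamma\Big[X,\frac{G}{\varepsilon+\Gamma[X]}\Big]+\frac{2G\,A[X]}{\varepsilon+\Gamma[X]}\Big)\Big).$$ If $G\ge0$ a.s., the limit on the right-hand side exists in $[-\infty,+\infty]$ for every $x\in\mathbb R$ and is a lower semicontinuous function of $x$. b) If in addition $\frac1{\Gamma[X]}\in\mathbb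 D\cap L^\infty$, then $\frac{G}{\Gamma[X]}\in\mathbb D$, $\Gamma\big[X,\frac{G}{\Gamma[X]}\big]+\frac{2G\,A[X]}{\Gamma[X]}$ is integrable, and for Lebesgue-almost every $x\in\mathbb R$, $$f(x)\,\mathbb E[G\mid X=x]=\frac12\,\mathbb E\Big(\operatorname{sign}(x-X)\Big(\Gamma\Big[X,\frac{G}{\Gamma[X]}\Big]+\frac{2G\,A[X]}{\Gamma[X]}\Big)\Big),$$ where the right-hand side is a continuous function of $x\in\mathbb R$. -/

import Mathlib

open MeasureTheory Filter Topology

/-- An error structure `(Ω, 𝒜, P, 𝔻, Γ)`: a probability space with a local Dirichlet form that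
admits a square field operator. `𝔻 = dom` is a dense subspace of `L²(P)`, `Γ = gamma` is a symmetric
positive bilinear map `𝔻 × 𝔻 → L¹(P)` obeying the functional calculus of class `C¹ ∩ Lip`, and the
form `u ↦ (1/2) E Γ[u]` is closed. (Constants belong to `𝔻`: take `F` constant in `calculus`.) -/
structure ErrorStructure {Ω : Type*} [MeasurableSpace Ω] (P : Measure Ω)
    [IsProbabilityMeasure P] where
  /-- The domain `𝔻` of the form. -/
  dom : Submodule ℝ (Lp ℝ 2 P)
  /-- The square field operator, on classes. -/
  gamma : dom →ₗ[ℝ] dom →ₗ[ℝ] Lp ℝ 1 P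
  dense_dom : Dense (dom : Set (Lp ℝ 2 P))
  gamma_symm : ∀ u v : dom, gamma u v = gamma v u
  gamma_nonneg : ∀ u : dom, ∀ᵐ ω ∂P, 0 ≤ (gamma u u : Ω → ℝ) ω
  calculus : ∀ (m n : ℕ) (u : Fin m → dom) (v : Fin n → dom)
    (F : (Fin m → ℝ) → ℝ) (H : (Fin n → ℝ) → ℝ),
    ContDiff ℝ 1 F → (∃ K, LipschitzWith K F) → ContDiff ℝ 1 H → (∃ K, LipschitzWith K H) →
    ∃ U V : dom,
      ((U : Lp ℝ 2 P) : Ω → ℝ) =ᵐ[P] (fun ω => F (fun i => (u i : Lp ℝ 2 P) ω)) ∧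
      ((V : Lp ℝ 2 P) : Ω → ℝ) =ᵐ[P] (fun ω => H (fun j => (v j : Lp ℝ 2 P) ω)) ∧
      (gamma U V : Ω → ℝ) =ᵐ[P] fun ω => ∑ i, ∑ j,
        fderiv ℝ F (fun k => (u k : Lp ℝ 2 P) ω) (Pi.single i 1) *
        fderiv ℝ H (fun k => (v k : Lp ℝ 2 P) ω) (Pi.single j 1) *
        (gamma (u i) (v j) : Ω → ℝ) ω
  /-- Completeness of `𝔻` for the norm `(‖u‖² + (1/2) E Γ[u])^(1/2)`. -/
  closed : ∀ u : ℕ → dom,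
    (∀ ε : ℝ, 0 < ε → ∃ N, ∀ p ≥ N, ∀ q ≥ N,
      ‖u p - u q‖ ^ 2 + 1 / 2 * ∫ ω, (gamma (u p - u q) (u p - u q) : Ω → ℝ) ω ∂P < ε) →
    ∃ w : dom, Tendsto (fun p =>
      ‖u p - w‖ ^ 2 + 1 / 2 * ∫ ω, (gamma (u p - w) (u p - w) : Ω → ℝ) ω ∂P) atTop (𝓝 0)

namespace ErrorStructure

variable {Ω : Type*} [MeasurableSpace Ω] {P : Measure Ω} [IsProbabilityMeasure P]

/-- `u ∈ 𝔻` for a function `u` on `Ω` : the class of `u` belongs to the domain. -/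
def MemD (E : ErrorStructure P) (u : Ω → ℝ) : Prop :=
  ∃ w : E.dom, ((w : Lp ℝ 2 P) : Ω → ℝ) =ᵐ[P] u

open Classical in
/-- A version of `Γ[u, v]` for functions `u, v ∈ 𝔻` (and `0` if one of them is not in `𝔻`). The
element of `dom` that represents `u` is unique. -/
noncomputable def Γ (E : ErrorStructure P) (u v : Ω → ℝ) : Ω → ℝ :=
  if h : E.MemD u ∧ E.MemD v then (E.gamma h.1.choose h.2.choose : Ω → ℝ) else fun _ => 0

/-- `u ∈ 𝒟A` and `A[u] = a` a.s., where `(A, 𝒟A)` is the generator: `u ∈ 𝔻`, `a ∈ L²(P)`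
and `ℰ[u, v] = -⟨a, v⟩` for all `v ∈ 𝔻`, with `ℰ[u, v] = (1/2) E Γ[u, v]`. Since `𝔻` is dense in
`L²(P)`, `a` is unique up to a null set. -/
def HasGenerator (E : ErrorStructure P) (u a : Ω → ℝ) : Prop :=
  E.MemD u ∧ MemLp a 2 P ∧
    ∀ v : Ω → ℝ, E.MemD v → 1 / 2 * ∫ ω, E.Γ u v ω ∂P = -∫ ω, a ω * v ω ∂P

end ErrorStructure

/-- `f` is a (version of the) density of the law of the real random variable `X`. -/
def IsDensityOf {Ω : Type*} [MeasurableSpace Ω] (P : Measure Ω) (X : Ω → ℝ) (f : ℝ → ℝ) : Prop :=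
  Measurable f ∧ (∀ x, 0 ≤ f x) ∧ P.map X = volume.withDensity (fun x => ENNReal.ofReal (f x))

/-- `g` is a version of `x ↦ E[G | X = x]`. -/
def IsCondExpGiven {Ω : Type*} [MeasurableSpace Ω] (P : Measure Ω) (X G : Ω → ℝ) (g : ℝ → ℝ) :
    Prop :=
  Measurable g ∧
    (fun ω => g (X ω)) =ᵐ[P] P[G | MeasurableSpace.comap X (inferInstance : MeasurableSpace ℝ)]

/-!
Let `ψ` be a bounded Lipschitz primitive of `-φ`, with `φ` continuous of compact support, and let
`W` be a bounded element of the domain `𝔻`. The product `ψ(X) W` is again in `𝔻` (bounded elements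
of `𝔻` form an algebra: `MemD.mul`, which applies the functional calculus to truncated
coordinates), and testing the generator against it gives
`E[φ(X) Γ[X] W] = E[ψ(X) K]` with `K = Γ[X, W] + 2 W A[X]`.
For `ψ(y) = (1/2) ∫ sign(x - y) φ(x) dx`, Fubini turns the right-hand side into `∫ φ h`, where
`h(x) = (1/2) E[sign(x - X) K]` (`HasGenerator.integral_comp_mul`). Hence the bounded function `h`
is the density of the image under `X` of the signed measure `Γ[X] W P`.

* With `W = 1 / (1 + Γ[X])` the measure `Γ[X] W P` is equivalent to `P`, so the law of `X` is
  absolutely continuous (`HasGenerator.map_absolutelyContinuous`). In particular it has no atoms,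
  and every `h` as above is continuous (`continuous_signMean`).
* If `f` is a density of `X` and `m(x) = E[Γ[X] W | X = x]`, then `h = f m` almost everywhere
  (`HasGenerator.signMean_ae_eq`). With `W = G / Γ[X]` this is the formula without a limit.
* With `W = G / (ε + Γ[X])` and `G ≥ 0`, the function `h` is nonincreasing in `ε`: almost everywhere
  because conditional expectation is monotone, hence everywhere by continuity. So the limit as `ε`
  tends to `0` is a supremum of continuous functions. It is `f(x) E[G | X = x]` for almost every
  `x`, since along a sequence `h` increases below this function and the integrals converge to `E[G]`
  (`HasGenerator.tendsto_regDensity_ae_of_nonneg`). A bounded `G` is the difference of the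
  nonnegative functions `G + C` and `C`, constants being in `𝔻`.
-/

/-! ### Functional calculus for the square field operator -/

/-- A compactly supported `C¹` function that is the identity, with derivative `1`, on `[-C, C]`.
It truncates bounded random variables without changing them, so that the product of two of them
becomes a Lipschitz function of the pair. -/
theorem exists_contDiff_truncation (C : ℝ) :
    ∃ χ : ℝ → ℝ, ContDiff ℝ 1 χ ∧ (∃ K, LipschitzWith K χ) ∧ (∃ B, ∀ t, |χ t| ≤ B) ∧
      ∀ t, |t| ≤ C → χ t = t ∧ deriv χ t = 1 := by
  let ρ : ContDiffBump (0 : ℝ) :=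
    ⟨|C| + 1, |C| + 2, by positivity, by linarith⟩
  have hsupp : HasCompactSupport fun t => ρ t * t := ρ.hasCompactSupport.mul_right
  have hχ : ContDiff ℝ 1 fun t => ρ t * t := ρ.contDiff.mul contDiff_id
  refine ⟨fun t => ρ t * t, hχ, hχ.lipschitzWith_of_hasCompactSupport hsupp one_ne_zero,
    hsupp.exists_bound_of_continuous hχ.continuous, fun t ht => ?_⟩
  have hmem : ∀ s ∈ Metric.ball (0 : ℝ) (|C| + 1), ρ s * s = s := fun s hs => by
    rw [ρ.one_of_mem_closedBall (Metric.ball_subset_closedBall hs), one_mul]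
  have htb : t ∈ Metric.ball (0 : ℝ) (|C| + 1) := by
    rw [mem_ball_zero_iff, Real.norm_eq_abs]
    linarith [le_abs_self C]
  refine ⟨hmem t htb, ?_⟩
  have : (fun s => ρ s * s) =ᶠ[𝓝 t] fun s => s := by
    filter_upwards [Metric.isOpen_ball.mem_nhds htb] with s hs using hmem s hs
  rw [this.deriv_eq]
  exact deriv_id t

theorem LipschitzWith.exists_mul_of_bounded {α : Type*} [PseudoMetricSpace α] {a b : α → ℝ}
    {K L : NNReal} (ha : LipschitzWith K a) (hb : LipschitzWith L b) {A B : ℝ}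
    (hA : ∀ x, |a x| ≤ A) (hB : ∀ x, |b x| ≤ B) :
    ∃ M, LipschitzWith M fun x => a x * b x := by
  refine ⟨A.toNNReal * L + B.toNNReal * K, LipschitzWith.of_dist_le_mul fun x y => ?_⟩
  have h1 := ha.dist_le_mul x y
  have h2 := hb.dist_le_mul x y
  have hA0 : 0 ≤ A := (abs_nonneg _).trans (hA x)
  have hB0 : 0 ≤ B := (abs_nonneg _).trans (hB x)
  rw [Real.dist_eq] at h1 h2 ⊢
  push_cast
  rw [Real.coe_toNNReal _ hA0, Real.coe_toNNReal _ hB0]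
  calc |a x * b x - a y * b y| = |a x * (b x - b y) + b y * (a x - a y)| := by ring_nf
    _ ≤ |a x| * |b x - b y| + |b y| * |a x - a y| := by
      rw [← abs_mul, ← abs_mul]; exact abs_add_le _ _
    _ ≤ A * (L * dist x y) + B * (K * dist x y) := by
      gcongr
      exacts [hA x, hB y]
    _ = _ := by ring

namespace ErrorStructure

variable {Ω : Type*} [MeasurableSpace Ω] {P : Measure Ω} [IsProbabilityMeasure P]
  {E : ErrorStructure P}

theorem Γ_eq_gamma {f g : Ω → ℝ} {u v : E.dom}
    (hu : ((u : Lp ℝ 2 P) : Ω → ℝ) =ᵐ[P] f) (hv : ((v : Lp ℝ 2 P) : Ω → ℝ) =ᵐ[P] g) :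
    E.Γ f g = (E.gamma u v : Ω → ℝ) := by
  have h : E.MemD f ∧ E.MemD g := ⟨⟨u, hu⟩, ⟨v, hv⟩⟩
  have h1 : h.1.choose = u := Subtype.ext (Lp.ext (h.1.choose_spec.trans hu.symm))
  have h2 : h.2.choose = v := Subtype.ext (Lp.ext (h.2.choose_spec.trans hv.symm))
  rw [Γ, dif_pos h, h1, h2]

theorem MemD.memLp {f : Ω → ℝ} (hf : E.MemD f) : MemLp f 2 P := by
  obtain ⟨u, hu⟩ := hf
  exact (memLp_congr_ae hu).1 (Lp.memLp _)

theorem MemD.congr {f g : Ω → ℝ} (hf : E.MemD f) (h : f =ᵐ[P] g) : E.MemD g := by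
  obtain ⟨u, hu⟩ := hf
  exact ⟨u, hu.trans h⟩

theorem integrable_Γ (E : ErrorStructure P) (f g : Ω → ℝ) : Integrable (E.Γ f g) P := by
  by_cases h : E.MemD f ∧ E.MemD g
  · obtain ⟨⟨u, hu⟩, ⟨v, hv⟩⟩ := h
    rw [Γ_eq_gamma hu hv]
    exact L1.integrable_coeFn _
  · rw [Γ, dif_neg h]
    exact integrable_zero _ _ _

theorem MemD.add {f g : Ω → ℝ} (hf : E.MemD f) (hg : E.MemD g) :
    E.MemD fun ω => f ω + g ω := by
  obtain ⟨u, hu⟩ := hf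
  obtain ⟨v, hv⟩ := hg
  exact ⟨u + v, (Lp.coeFn_add _ _).trans (hu.add hv)⟩

theorem Γ_add_right {w f g : Ω → ℝ} (hw : E.MemD w) (hf : E.MemD f) (hg : E.MemD g) :
    E.Γ w (fun ω => f ω + g ω) =ᵐ[P] fun ω => E.Γ w f ω + E.Γ w g ω := by
  obtain ⟨t, ht⟩ := hw
  obtain ⟨u, hu⟩ := hf
  obtain ⟨v, hv⟩ := hg
  have huv : (((u + v : E.dom) : Lp ℝ 2 P) : Ω → ℝ) =ᵐ[P] fun ω => f ω + g ω :=
    (Lp.coeFn_add _ _).trans (hu.add hv)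
  rw [Γ_eq_gamma ht huv, Γ_eq_gamma ht hu, Γ_eq_gamma ht hv, map_add]
  exact Lp.coeFn_add _ _

/-- The functional calculus with the identity in the first slot. -/
theorem exists_gamma_calculus (E : ErrorStructure P) {n : ℕ} (v : Fin n → E.dom)
    {H : (Fin n → ℝ) → ℝ} (hH : ContDiff ℝ 1 H) (hL : ∃ K, LipschitzWith K H) :
    ∃ V : E.dom, ((V : Lp ℝ 2 P) : Ω → ℝ) =ᵐ[P] (fun ω => H (fun j => (v j : Lp ℝ 2 P) ω)) ∧
      ∀ w : E.dom, (E.gamma w V : Ω → ℝ) =ᵐ[P] fun ω => ∑ j,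
        fderiv ℝ H (fun k => (v k : Lp ℝ 2 P) ω) (Pi.single j 1) *
        (E.gamma w (v j) : Ω → ℝ) ω := by
  have key : ∀ w : E.dom, ∃ V : E.dom,
      ((V : Lp ℝ 2 P) : Ω → ℝ) =ᵐ[P] (fun ω => H (fun j => (v j : Lp ℝ 2 P) ω)) ∧
      (E.gamma w V : Ω → ℝ) =ᵐ[P] fun ω => ∑ j,
        fderiv ℝ H (fun k => (v k : Lp ℝ 2 P) ω) (Pi.single j 1) *
        (E.gamma w (v j) : Ω → ℝ) ω := fun w => by
    obtain ⟨U, V, hU, hV, h⟩ := E.calculus 1 n (fun _ => w) v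
      (ContinuousLinearMap.proj (R := ℝ) (φ := fun _ : Fin 1 => ℝ) 0) H
      (ContinuousLinearMap.contDiff _) ⟨_, ContinuousLinearMap.lipschitz _⟩ hH hL
    obtain rfl : U = w := Subtype.ext (Lp.ext hU)
    refine ⟨V, hV, h.trans (Eventually.of_forall fun ω => ?_)⟩
    simp only [Fin.sum_univ_one, ContinuousLinearMap.fderiv]
    simp
  obtain ⟨V, hV, -⟩ := key 0
  refine ⟨V, hV, fun w => ?_⟩
  obtain ⟨V', hV', h⟩ := key w
  obtain rfl : V' = V := Subtype.ext (Lp.ext (hV'.trans hV.symm))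
  exact h

/-- Chain rule for one variable. -/
theorem MemD.comp {u : Ω → ℝ} (hu : E.MemD u) {φ : ℝ → ℝ} (hφ : ContDiff ℝ 1 φ)
    (hL : ∃ K, LipschitzWith K φ) :
    E.MemD (fun ω => φ (u ω)) ∧ ∀ w, E.MemD w →
      E.Γ w (fun ω => φ (u ω)) =ᵐ[P] fun ω => deriv φ (u ω) * E.Γ w u ω := by
  obtain ⟨U, hU⟩ := hu
  obtain ⟨K, hK⟩ := hL
  let p : (Fin 1 → ℝ) →L[ℝ] ℝ := ContinuousLinearMap.proj 0
  obtain ⟨V, hV, h⟩ := E.exists_gamma_calculus (fun _ : Fin 1 => U) (H := φ ∘ p)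
    (hφ.comp p.contDiff) ⟨_, hK.comp p.lipschitz⟩
  have hV' : ((V : Lp ℝ 2 P) : Ω → ℝ) =ᵐ[P] fun ω => φ (u ω) := by
    filter_upwards [hV, hU] with ω h1 h2
    rw [h1, ← h2]
    rfl
  refine ⟨⟨V, hV'⟩, fun w ⟨W, hW⟩ => ?_⟩
  rw [Γ_eq_gamma hW hV', Γ_eq_gamma hW hU]
  filter_upwards [h W, hU] with ω h1 h2
  have hd : HasFDerivAt (φ ∘ p) (deriv φ (u ω) • p) (fun _ => (U : Lp ℝ 2 P) ω) := by
    rw [← h2]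
    exact ((hφ.differentiable one_ne_zero).differentiableAt
      (x := (U : Lp ℝ 2 P) ω)).hasDerivAt.comp_hasFDerivAt
        (fun _ : Fin 1 => (U : Lp ℝ 2 P) ω) p.hasFDerivAt
  rw [h1, Fin.sum_univ_one, hd.fderiv]
  simp [p]

theorem MemD.const (E : ErrorStructure P) (c : ℝ) : E.MemD fun _ => c :=
  (MemD.comp (u := fun _ => 0) ⟨0, Lp.coeFn_zero _ _ _⟩ (φ := fun _ => c) contDiff_const
    ⟨0, LipschitzWith.const c⟩).1

/-- Bounded elements of the domain form an algebra, on which `Γ` obeys the Leibniz rule. -/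
theorem MemD.mul {u v : Ω → ℝ} (hu : E.MemD u) (hv : E.MemD v) {C D : ℝ}
    (huC : ∀ᵐ ω ∂P, |u ω| ≤ C) (hvD : ∀ᵐ ω ∂P, |v ω| ≤ D) :
    E.MemD (fun ω => u ω * v ω) ∧ ∀ w, E.MemD w →
      E.Γ w (fun ω => u ω * v ω) =ᵐ[P] fun ω => v ω * E.Γ w u ω + u ω * E.Γ w v ω := by
  obtain ⟨U, hU⟩ := hu
  obtain ⟨V, hV⟩ := hv
  obtain ⟨χ, hχ, ⟨K, hK⟩, ⟨B, hB⟩, hχC⟩ := exists_contDiff_truncation C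
  obtain ⟨θ, hθ, ⟨L, hL⟩, ⟨B', hB'⟩, hθD⟩ := exists_contDiff_truncation D
  let p (i : Fin 2) : (Fin 2 → ℝ) →L[ℝ] ℝ := ContinuousLinearMap.proj i
  obtain ⟨Z, hZ, h⟩ := E.exists_gamma_calculus ![U, V]
    (H := fun x => (χ ∘ p 0) x * (θ ∘ p 1) x)
    ((hχ.comp (p 0).contDiff).mul (hθ.comp (p 1).contDiff))
    ((hK.comp (p 0).lipschitz).exists_mul_of_bounded (hL.comp (p 1).lipschitz)
      (fun x => hB _) (fun x => hB' _))
  have hZ' : ((Z : Lp ℝ 2 P) : Ω → ℝ) =ᵐ[P] fun ω => u ω * v ω := by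
    filter_upwards [hZ, hU, hV, huC, hvD] with ω h1 h2 h3 h4 h5
    rw [h1]
    simp [p, h2, h3, (hχC _ h4).1, (hθD _ h5).1]
  refine ⟨⟨Z, hZ'⟩, fun w ⟨W, hW⟩ => ?_⟩
  rw [Γ_eq_gamma hW hZ', Γ_eq_gamma hW hU, Γ_eq_gamma hW hV]
  filter_upwards [h W, hU, hV, huC, hvD] with ω h1 h2 h3 h4 h5
  set x : Fin 2 → ℝ := fun k => (![U, V] k : Lp ℝ 2 P) ω with hx
  have hx0 : p 0 x = u ω := h2
  have hx1 : p 1 x = v ω := h3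
  have d0 : HasFDerivAt (χ ∘ p 0) ((1 : ℝ) • p 0) x := by
    have := ((hχ.differentiable one_ne_zero).differentiableAt
      (x := p 0 x)).hasDerivAt.comp_hasFDerivAt x (p 0).hasFDerivAt
    rwa [hx0, (hχC _ h4).2] at this
  have d1 : HasFDerivAt (θ ∘ p 1) ((1 : ℝ) • p 1) x := by
    have := ((hθ.differentiable one_ne_zero).differentiableAt
      (x := p 1 x)).hasDerivAt.comp_hasFDerivAt x (p 1).hasFDerivAt
    rwa [hx1, (hθD _ h5).2] at this
  have hd : HasFDerivAt (fun x => (χ ∘ p 0) x * (θ ∘ p 1) x) _ x := d0.mul d1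
  rw [Function.comp_apply, Function.comp_apply, hx0, hx1, (hχC _ h4).1, (hθD _ h5).1] at hd
  rw [h1, Fin.sum_univ_two, hd.fderiv]
  simp [p]

end ErrorStructure

/-! ### Primitives given by the sign kernel -/

theorem measurable_real_sign : Measurable Real.sign := by
  unfold Real.sign
  exact Measurable.ite measurableSet_Iio measurable_const
    (Measurable.ite measurableSet_Ioi measurable_const measurable_const)

theorem norm_real_sign_le (t : ℝ) : ‖Real.sign t‖ ≤ 1 := by
  rcases Real.sign_apply_eq t with h | h | h <;> simp [h]

theorem continuousAt_real_sign {t : ℝ} (ht : t ≠ 0) : ContinuousAt Real.sign t := by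
  rcases ht.lt_or_gt with h | h
  · refine (continuousAt_const (y := (-1 : ℝ))).congr ?_
    filter_upwards [Iio_mem_nhds h] with s hs using (Real.sign_of_neg hs).symm
  · refine (continuousAt_const (y := (1 : ℝ))).congr ?_
    filter_upwards [Ioi_mem_nhds h] with s hs using (Real.sign_of_pos hs).symm

theorem integral_sign_mul {φ : ℝ → ℝ} (hφ : Integrable φ) (y : ℝ) :
    ∫ x, Real.sign (x - y) * φ x = (∫ x, φ x) - 2 * ∫ x in Set.Iic y, φ x := by
  have h : (fun x => Real.sign (x - y) * φ x) =ᵐ[volume]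
      fun x => φ x - 2 * (Set.Iic y).indicator φ x := by
    filter_upwards [Measure.ae_ne volume y] with x hx
    rcases hx.lt_or_gt with h | h
    · rw [Real.sign_of_neg (sub_neg.2 h), Set.indicator_of_mem (Set.mem_Iic.2 h.le)]
      ring
    · rw [Real.sign_of_pos (sub_pos.2 h), Set.indicator_of_notMem (by simpa using h)]
      ring
  rw [integral_congr_ae h, integral_sub hφ ((hφ.indicator measurableSet_Iic).const_mul 2),
    integral_const_mul, integral_indicator measurableSet_Iic]

theorem hasDerivAt_integral_sign_mul {φ : ℝ → ℝ} (hφ : Continuous φ) (hi : Integrable φ) (y : ℝ) :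
    HasDerivAt (fun y => 1 / 2 * ∫ x, Real.sign (x - y) * φ x) (-φ y) y := by
  have h : (fun y => 1 / 2 * ∫ x, Real.sign (x - y) * φ x) =
      fun y => (1 / 2 * (∫ x, φ x) - ∫ x in Set.Iic 0, φ x) - ∫ x in (0 : ℝ)..y, φ x := by
    funext y
    rw [integral_sign_mul hi, ← intervalIntegral.integral_Iic_sub_Iic hi.integrableOn
      hi.integrableOn]
    ring
  rw [h]
  exact (intervalIntegral.integral_hasDerivAt_right (hφ.intervalIntegrable _ _)
    hφ.stronglyMeasurable.stronglyMeasurableAtFilter hφ.continuousAt).const_sub _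

theorem exists_contDiff_lipschitz_of_hasDerivAt {ψ ψ' : ℝ → ℝ} (h : ∀ y, HasDerivAt ψ (ψ' y) y)
    (hc : Continuous ψ') {C : ℝ} (hC : ∀ y, |ψ' y| ≤ C) :
    ContDiff ℝ 1 ψ ∧ ∃ K, LipschitzWith K ψ := by
  have hd : deriv ψ = ψ' := funext fun y => (h y).deriv
  have hdiff : Differentiable ℝ ψ := fun y => (h y).differentiableAt
  refine ⟨contDiff_one_iff_deriv.2 ⟨hdiff, hd ▸ hc⟩, C.toNNReal,
    lipschitzWith_of_nnnorm_deriv_le hdiff fun y => ?_⟩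
  rw [hd, ← NNReal.coe_le_coe, coe_nnnorm, Real.norm_eq_abs]
  exact (hC y).trans (Real.le_coe_toNNReal C)

/-! ### Sign averages of an integrable random variable -/

/-- The function `x ↦ (1/2) E[sign(x - X) K]`. It is the distributional primitive of the image under
`X` of the signed measure `K P`, normalised to have opposite limits at `±∞`. -/
noncomputable def signMean {Ω : Type*} [MeasurableSpace Ω] (P : Measure Ω) (X K : Ω → ℝ) (x : ℝ) :
    ℝ :=
  1 / 2 * ∫ ω, Real.sign (x - X ω) * K ω ∂P

section SignMean

variable {Ω : Type*} [MeasurableSpace Ω] {P : Measure Ω}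
  {X K : Ω → ℝ}

theorem integrable_sign_mul (hX : Measurable X) (hK : Integrable K P) (x : ℝ) :
    Integrable (fun ω => Real.sign (x - X ω) * K ω) P :=
  hK.bdd_mul (measurable_real_sign.comp (measurable_const.sub hX)).aestronglyMeasurable
    (Eventually.of_forall fun _ => norm_real_sign_le _)

theorem abs_signMean_le (hX : Measurable X) (hK : Integrable K P) (x : ℝ) :
    |signMean P X K x| ≤ ∫ ω, |K ω| ∂P := by
  have h : |∫ ω, Real.sign (x - X ω) * K ω ∂P| ≤ ∫ ω, |K ω| ∂P := by
    refine abs_integral_le_integral_abs.trans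
      (integral_mono (integrable_sign_mul hX hK x).abs hK.abs fun ω => ?_)
    simp only [abs_mul]
    exact mul_le_of_le_one_left (abs_nonneg _) (norm_real_sign_le _)
  rw [signMean, abs_mul, abs_of_pos (by norm_num : (0 : ℝ) < 1 / 2)]
  linarith [integral_nonneg (μ := P) (f := fun ω => |K ω|) fun ω => abs_nonneg (K ω)]

theorem aestronglyMeasurable_signMean [SFinite P] (hX : Measurable X) (hK : Integrable K P) :
    AEStronglyMeasurable (signMean P X K) volume := by
  have h : AEStronglyMeasurable (fun z : ℝ × Ω => Real.sign (z.1 - X z.2) * K z.2)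
      (volume.prod P) :=
    (measurable_real_sign.comp
      (measurable_fst.sub (hX.comp measurable_snd))).aestronglyMeasurable.mul
      hK.aestronglyMeasurable.comp_snd
  exact h.integral_prod_right'.const_mul _

theorem locallyIntegrable_signMean [SFinite P] (hX : Measurable X) (hK : Integrable K P) :
    LocallyIntegrable (signMean P X K) volume :=
  (locallyIntegrable_const (∫ ω, |K ω| ∂P)).mono (aestronglyMeasurable_signMean hX hK)
    (Eventually.of_forall fun x => (abs_signMean_le hX hK x).trans (le_abs_self _))

theorem integral_mul_signMean [SFinite P] (hX : Measurable X) (hK : Integrable K P) {φ : ℝ → ℝ}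
    (hφ : Integrable φ) :
    ∫ x, φ x * signMean P X K x = ∫ ω, (1 / 2 * ∫ x, Real.sign (x - X ω) * φ x) * K ω ∂P := by
  have hint : Integrable (Function.uncurry fun x ω => Real.sign (x - X ω) * (φ x * K ω))
      (volume.prod P) :=
    (hφ.mul_prod hK).bdd_mul (measurable_real_sign.comp
      (measurable_fst.sub (hX.comp measurable_snd))).aestronglyMeasurable
      (Eventually.of_forall fun _ => norm_real_sign_le _)
  calc ∫ x, φ x * signMean P X K x
      = 1 / 2 * ∫ x, ∫ ω, Real.sign (x - X ω) * (φ x * K ω) ∂P := by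
        rw [← integral_const_mul]
        refine integral_congr_ae (Eventually.of_forall fun x => ?_)
        simp only [signMean]
        rw [mul_left_comm, ← integral_const_mul]
        simp only [mul_left_comm]
    _ = 1 / 2 * ∫ ω, (∫ x, Real.sign (x - X ω) * (φ x * K ω)) ∂P := by
        rw [integral_integral_swap hint]
    _ = _ := by
        rw [← integral_const_mul]
        refine integral_congr_ae (Eventually.of_forall fun ω => ?_)
        simp only [← mul_assoc, integral_mul_const]

/-- If the law of `X` has no atom then `x ↦ sign(x - X)` is almost surely continuous at each given
point, and dominated convergence applies. -/
theorem continuous_signMean (hX : Measurable X) (hK : Integrable K P)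
    (hac : P.map X ≪ volume) : Continuous (signMean P X K) := by
  refine continuous_const.mul (continuous_iff_continuousAt.2 fun x => ?_)
  refine continuousAt_of_dominated (bound := fun ω => |K ω|)
    (Eventually.of_forall fun y => (integrable_sign_mul hX hK y).aestronglyMeasurable)
    (Eventually.of_forall fun y => Eventually.of_forall fun ω => ?_) hK.abs ?_
  · rw [norm_mul]
    exact mul_le_of_le_one_left (abs_nonneg _) (norm_real_sign_le _)
  · have : ∀ᵐ ω ∂P, X ω ≠ x :=
      ae_of_ae_map hX.aemeasurable (hac.ae_le (Measure.ae_ne volume x))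
    filter_upwards [this] with ω hω
    have h : x - X ω ≠ 0 := sub_ne_zero.2 hω.symm
    exact (ContinuousAt.comp (f := fun y => y - X ω) (continuousAt_real_sign h)
      (continuousAt_id.sub continuousAt_const)).mul continuousAt_const

end SignMean

/-! ### Densities and conditional expectations -/

theorem absolutelyContinuous_of_integral_le {ν : Measure ℝ} [IsFiniteMeasure ν] {C : ℝ}
    (hC : 0 ≤ C) (h : ∀ φ : ℝ → ℝ, Continuous φ → HasCompactSupport φ → (∀ x, 0 ≤ φ x) →
      ∫ x, φ x ∂ν ≤ C * ∫ x, φ x) : ν ≪ volume := by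
  refine Measure.AbsolutelyContinuous.mk fun s hs hs0 => ?_
  rw [hs.measure_eq_iSup_isCompact]
  simp only [ENNReal.iSup_eq_zero]
  intro k hks hk
  have hk0 : volume k = 0 := measure_mono_null hks hs0
  have hle : ∀ δ : ℝ, 0 < δ → ν.real k ≤ C * δ := fun δ hδ => by
    obtain ⟨U, hkU, hU, hUδ⟩ := k.exists_isOpen_lt_of_lt (μ := volume) (ENNReal.ofReal δ)
      (by rw [hk0]; exact ENNReal.ofReal_pos.2 hδ)
    obtain ⟨φ, h1, h0, hsupp, h01⟩ := exists_continuous_one_zero_of_isCompact hk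
      hU.isClosed_compl (Set.disjoint_compl_right_iff_subset.2 hkU)
    have hUr : volume.real U ≤ δ := ENNReal.toReal_le_of_le_ofReal hδ.le hUδ.le
    calc ν.real k = ∫ x, k.indicator 1 x ∂ν := (integral_indicator_one hk.measurableSet).symm
      _ ≤ ∫ x, φ x ∂ν := by
        refine integral_mono ((integrable_const (1 : ℝ)).indicator hk.measurableSet)
          (φ.continuous.integrable_of_hasCompactSupport hsupp) fun x => ?_
        by_cases hx : x ∈ k
        · simp [hx, h1 hx]
        · simpa [hx] using (h01 x).1
      _ ≤ C * ∫ x, φ x := h φ φ.continuous hsupp fun x => (h01 x).1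
      _ ≤ C * ∫ x, U.indicator 1 x := by
        refine mul_le_mul_of_nonneg_left (integral_mono
          (φ.continuous.integrable_of_hasCompactSupport hsupp)
          ((integrable_indicator_iff hU.measurableSet).2
            (integrableOn_const (hUδ.trans ENNReal.ofReal_lt_top).ne)) fun x => ?_) hC
        by_cases hx : x ∈ U
        · simpa [hx] using (h01 x).2
        · simp [hx, h0 (show x ∈ Uᶜ from hx)]
      _ ≤ C * δ := by
        rw [integral_indicator_one hU.measurableSet]
        exact mul_le_mul_of_nonneg_left hUr hC
  have hlim : Tendsto (fun δ : ℝ => C * δ) (𝓝[>] 0) (𝓝 0) := by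
    have h0 : Continuous fun δ : ℝ => C * δ := by fun_prop
    exact (h0.tendsto' 0 0 (mul_zero C)).mono_left nhdsWithin_le_nhds
  have : ν.real k ≤ 0 := ge_of_tendsto hlim (by
    filter_upwards [self_mem_nhdsWithin] with δ hδ using hle δ hδ)
  exact (measureReal_eq_zero_iff).1 (le_antisymm this measureReal_nonneg)

section CondExp

variable {Ω : Type*} [MeasurableSpace Ω] {P : Measure Ω}
  {X : Ω → ℝ} {f : ℝ → ℝ}

theorem exists_isDensityOf [IsProbabilityMeasure P] (hX : Measurable X) (hac : P.map X ≪ volume) :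
    ∃ f, IsDensityOf P X f := by
  have := Measure.isProbabilityMeasure_map (μ := P) hX.aemeasurable
  refine ⟨fun x => ((P.map X).rnDeriv volume x).toReal,
    (Measure.measurable_rnDeriv _ _).ennreal_toReal, fun _ => ENNReal.toReal_nonneg, ?_⟩
  rw [← withDensity_congr_ae (f := (P.map X).rnDeriv volume),
    Measure.withDensity_rnDeriv_eq _ _ hac]
  filter_upwards [Measure.rnDeriv_lt_top (P.map X) volume] with x hx
  rw [ENNReal.ofReal_toReal hx.ne]

theorem exists_isCondExpGiven (P : Measure Ω) (X Z : Ω → ℝ) : ∃ m, IsCondExpGiven P X Z m := by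
  obtain ⟨m, hm, h⟩ := (stronglyMeasurable_condExp (μ := P) (f := Z)
    (m := MeasurableSpace.comap X inferInstance)).measurable.exists_eq_measurable_comp
  exact ⟨m, hm, by rw [h]; rfl⟩

theorem IsDensityOf.integral_comp (hf : IsDensityOf P X f) (hX : Measurable X) {k : ℝ → ℝ}
    (hk : Measurable k) : ∫ ω, k (X ω) ∂P = ∫ x, f x * k x := by
  rw [← integral_map hX.aemeasurable hk.aestronglyMeasurable, hf.2.2,
    integral_withDensity_eq_integral_toReal_smul hf.1.ennreal_ofReal
      (Eventually.of_forall fun _ => ENNReal.ofReal_lt_top)]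
  simp only [ENNReal.toReal_ofReal (hf.2.1 _), smul_eq_mul]

variable {Z : Ω → ℝ} {m : ℝ → ℝ}

theorem IsDensityOf.integrable_mul (hf : IsDensityOf P X f) (hX : Measurable X)
    (hm : IsCondExpGiven P X Z m) : Integrable fun x => f x * m x := by
  have h : Integrable (fun ω => m (X ω)) P := (integrable_congr hm.2).2 integrable_condExp
  have h' : Integrable m (P.map X) :=
    (integrable_map_measure hm.1.aestronglyMeasurable hX.aemeasurable).2 h
  rw [hf.2.2, integrable_withDensity_iff_integrable_smul₀' hf.1.ennreal_ofReal.aemeasurable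
    (Eventually.of_forall fun _ => ENNReal.ofReal_lt_top)] at h'
  simpa only [ENNReal.toReal_ofReal (hf.2.1 _), smul_eq_mul] using h'

/-- `f m` is the density of the image under `X` of the signed measure `Z P`. -/
theorem IsDensityOf.integral_mul_comp [IsProbabilityMeasure P] (hf : IsDensityOf P X f)
    (hX : Measurable X) (hZ : Integrable Z P) (hm : IsCondExpGiven P X Z m)
    {φ : ℝ → ℝ} (hφ : Measurable φ) {C : ℝ}
    (hC : ∀ x, |φ x| ≤ C) : ∫ ω, φ (X ω) * Z ω ∂P = ∫ x, φ x * (f x * m x) := by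
  have hle : MeasurableSpace.comap X inferInstance ≤ ‹MeasurableSpace Ω› := hX.comap_le
  have hφX : Measurable[MeasurableSpace.comap X inferInstance] fun ω => φ (X ω) :=
    hφ.comp (comap_measurable X)
  have hi : Integrable ((fun ω => φ (X ω)) * Z) P :=
    hZ.bdd_mul (hφ.comp hX).aestronglyMeasurable (Eventually.of_forall fun ω => hC (X ω))
  calc ∫ ω, φ (X ω) * Z ω ∂P
      = ∫ ω, (P[(fun ω => φ (X ω)) * Z | MeasurableSpace.comap X inferInstance]) ω ∂P :=
        (integral_condExp hle).symm
    _ = ∫ ω, φ (X ω) * m (X ω) ∂P := by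
        refine integral_congr_ae ?_
        filter_upwards [condExp_mul_of_stronglyMeasurable_left hφX.stronglyMeasurable hi hZ, hm.2]
          with ω h1 h2
        rw [h1, Pi.mul_apply, h2]
    _ = ∫ x, φ x * (f x * m x) := by
        rw [hf.integral_comp hX (k := fun x => φ x * m x) (hφ.mul hm.1)]
        simp only [mul_left_comm]

theorem IsDensityOf.integral_mul [IsProbabilityMeasure P] (hf : IsDensityOf P X f)
    (hX : Measurable X) (hZ : Integrable Z P) (hm : IsCondExpGiven P X Z m) :
    ∫ x, f x * m x = ∫ ω, Z ω ∂P := by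
  simpa using (hf.integral_mul_comp hX hZ hm (φ := fun _ => 1) measurable_const (C := 1)
    (by simp)).symm

theorem IsDensityOf.mul_le_mul (hf : IsDensityOf P X f) (hX : Measurable X) {Z' : Ω → ℝ}
    {m' : ℝ → ℝ} (hZ : Integrable Z P) (hZ' : Integrable Z' P) (hm : IsCondExpGiven P X Z m)
    (hm' : IsCondExpGiven P X Z' m') (h : Z ≤ᵐ[P] Z') :
    ∀ᵐ x, f x * m x ≤ f x * m' x := by
  have h1 : ∀ᵐ ω ∂P, m (X ω) ≤ m' (X ω) := by
    filter_upwards [condExp_mono (m := MeasurableSpace.comap X inferInstance) hZ hZ' h, hm.2,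
      hm'.2] with ω h1 h2 h3
    rwa [h2, h3]
  have h2 : ∀ᵐ x ∂P.map X, m x ≤ m' x :=
    (ae_map_iff hX.aemeasurable (measurableSet_le hm.1 hm'.1)).2 h1
  rw [hf.2.2, ae_withDensity_iff hf.1.ennreal_ofReal] at h2
  filter_upwards [h2] with x hx
  rcases (hf.2.1 x).eq_or_lt with h0 | h0
  · simp [← h0]
  · exact mul_le_mul_of_nonneg_left (hx (ENNReal.ofReal_pos.2 h0).ne') h0.le

end CondExp

/-! ### Integration by parts -/

theorem Continuous.le_of_ae_le_volume {h k : ℝ → ℝ} (hh : Continuous h) (hk : Continuous k)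
    (hle : ∀ᵐ x, h x ≤ k x) (x : ℝ) : h x ≤ k x := by
  have hu := (Measure.dense_of_ae hle).closure_eq
  rw [(isClosed_le hh hk).closure_eq] at hu
  exact Set.eq_univ_iff_forall.1 hu x

theorem abs_div_const_add_le {Ω : Type*} [MeasurableSpace Ω] {P : Measure Ω} {G S : Ω → ℝ} {C : ℝ}
    (hC : ∀ᵐ ω ∂P, |G ω| ≤ C) (hS0 : ∀ᵐ ω ∂P, 0 ≤ S ω) {ε : ℝ} (hε : 0 < ε) :
    ∀ᵐ ω ∂P, |G ω / (ε + S ω)| ≤ C / ε := by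
  filter_upwards [hC, hS0] with ω h1 h2
  rw [abs_div, abs_of_pos (by linarith : 0 < ε + S ω)]
  have : 0 ≤ C := (abs_nonneg _).trans h1
  gcongr
  linarith

namespace ErrorStructure

variable {Ω : Type*} [MeasurableSpace Ω] {P : Measure Ω} [IsProbabilityMeasure P]
  {E : ErrorStructure P}

/-- The random variable `Γ[X, W] + 2 W A[X]`, which the integration by parts formula
`E[φ'(X) Γ[X] W] = -E[φ(X) (Γ[X, W] + 2 W A[X])]` puts in front of `φ(X)`. -/
noncomputable def ibpWeight (E : ErrorStructure P) (X AX W : Ω → ℝ) (ω : Ω) : ℝ :=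
  E.Γ X W ω + 2 * W ω * AX ω

variable {X AX : Ω → ℝ}

theorem HasGenerator.integrable_ibpWeight (hXA : E.HasGenerator X AX) {W : Ω → ℝ}
    (hW : E.MemD W) {C : ℝ} (hC : ∀ᵐ ω ∂P, |W ω| ≤ C) :
    Integrable (E.ibpWeight X AX W) P := by
  refine (E.integrable_Γ X W).add ?_
  have h := ((hXA.2.1.integrable one_le_two).bdd_mul hW.memLp.aestronglyMeasurable
    hC).const_mul 2
  exact h.congr (Eventually.of_forall fun ω => (mul_assoc _ _ _).symm)

/-- The generator is tested against `ψ(X) W`, where `ψ(y) = (1/2) ∫ sign(x - y) φ(x) dx` is a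
bounded Lipschitz function with derivative `-φ`. -/
theorem HasGenerator.integral_comp_mul (hXA : E.HasGenerator X AX) (hX : Measurable X)
    {W : Ω → ℝ} (hW : E.MemD W) {C : ℝ} (hC : ∀ᵐ ω ∂P, |W ω| ≤ C) {φ : ℝ → ℝ}
    (hφ : Continuous φ) (hsupp : HasCompactSupport φ) :
    ∫ ω, φ (X ω) * (E.Γ X X ω * W ω) ∂P =
      ∫ x, φ x * signMean P X (E.ibpWeight X AX W) x := by
  have hi : Integrable φ := hφ.integrable_of_hasCompactSupport hsupp
  obtain ⟨B, hB⟩ := hsupp.exists_bound_of_continuous hφ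
  rw [integral_mul_signMean hX (hXA.integrable_ibpWeight hW hC) hi]
  set ψ : ℝ → ℝ := fun y => 1 / 2 * ∫ x, Real.sign (x - y) * φ x with hψ
  have hψd : ∀ y, HasDerivAt ψ (-φ y) y := hasDerivAt_integral_sign_mul hφ hi
  obtain ⟨hψ1, hψL⟩ := exists_contDiff_lipschitz_of_hasDerivAt hψd hφ.neg
    (C := B) fun y => by rw [abs_neg]; exact hB y
  have hψb : ∀ y, |ψ y| ≤ 1 / 2 * ∫ x, |φ x| := fun y => by
    rw [hψ]
    simp only [abs_mul]
    rw [abs_of_pos (by norm_num : (0 : ℝ) < 1 / 2)]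
    gcongr
    change ‖∫ x, Real.sign (x - y) * φ x‖ ≤ ∫ x, |φ x|
    refine norm_integral_le_of_norm_le hi.abs (Eventually.of_forall fun x => ?_)
    rw [norm_mul]
    exact mul_le_of_le_one_left (abs_nonneg _) (norm_real_sign_le _)
  obtain ⟨hψD, hΓψ⟩ := hXA.1.comp hψ1 hψL
  obtain ⟨hVD, hΓV⟩ := hψD.mul hW (Eventually.of_forall fun ω => hψb (X ω)) hC
  have h1 : ∫ ω, E.Γ X (fun ω => ψ (X ω) * W ω) ω ∂P =
      ∫ ω, (ψ (X ω) * E.Γ X W ω - φ (X ω) * (E.Γ X X ω * W ω)) ∂P := by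
    refine integral_congr_ae ?_
    filter_upwards [hΓV X hXA.1, hΓψ X hXA.1] with ω h2 h3
    rw [h2, h3, (hψd _).deriv]
    ring
  have hXψ : AEStronglyMeasurable (fun ω => ψ (X ω)) P :=
    (hψ1.continuous.measurable.comp hX).aestronglyMeasurable
  have i1 : Integrable (fun ω => ψ (X ω) * E.Γ X W ω) P :=
    (E.integrable_Γ X W).bdd_mul hXψ (Eventually.of_forall fun ω => hψb (X ω))
  have i2 : Integrable (fun ω => φ (X ω) * (E.Γ X X ω * W ω)) P :=
    ((E.integrable_Γ X X).mul_bdd hW.memLp.aestronglyMeasurable hC).bdd_mul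
      (hφ.measurable.comp hX).aestronglyMeasurable (Eventually.of_forall fun ω => hB (X ω))
  have i3 : Integrable (fun ω => AX ω * (ψ (X ω) * W ω)) P :=
    hXA.2.1.integrable_mul hVD.memLp
  have h4 := hXA.2.2 _ hVD
  rw [h1, integral_sub i1 i2] at h4
  have h5 : ∫ ω, ψ (X ω) * E.ibpWeight X AX W ω ∂P =
      ∫ ω, ψ (X ω) * E.Γ X W ω ∂P + 2 * ∫ ω, AX ω * (ψ (X ω) * W ω) ∂P := by
    rw [← integral_const_mul, ← integral_add i1 (i3.const_mul 2)]
    refine integral_congr_ae (Eventually.of_forall fun ω => ?_)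
    simp only [ibpWeight]
    ring
  rw [h5]
  linarith

/-- The factor `1 / (ε + y)` agrees for `y ≥ 0` with the `C¹` Lipschitz function
`1 / ε - ∫₀^y (ε + |t|)⁻² dt`, which is defined on the whole line. -/
theorem MemD.one_div_const_add {S : Ω → ℝ} (hS : E.MemD S) (hS0 : ∀ᵐ ω ∂P, 0 ≤ S ω) {ε : ℝ}
    (hε : 0 < ε) : E.MemD fun ω => 1 / (ε + S ω) := by
  have hpos : ∀ t : ℝ, 0 < ε + |t| := fun t => by positivity
  have hc : Continuous fun t : ℝ => -(1 / (ε + |t|) ^ 2) :=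
    (continuous_const.div (by fun_prop) fun t => (pow_pos (hpos t) 2).ne').neg
  let k : ℝ → ℝ := fun y => 1 / ε + ∫ t in (0 : ℝ)..y, -(1 / (ε + |t|) ^ 2)
  have hk : ∀ y, HasDerivAt k (-(1 / (ε + |y|) ^ 2)) y := fun y =>
    (intervalIntegral.integral_hasDerivAt_right (hc.intervalIntegrable _ _)
      hc.stronglyMeasurable.stronglyMeasurableAtFilter hc.continuousAt).const_add _
  have hk0 : ∀ y, 0 ≤ y → k y = 1 / (ε + y) := fun y hy => by
    have : ∫ t in (0 : ℝ)..y, -(1 / (ε + |t|) ^ 2) = 1 / (ε + y) - 1 / (ε + 0) := by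
      refine intervalIntegral.integral_eq_sub_of_hasDerivAt (f := fun t => 1 / (ε + t))
        (fun t ht => ?_) (hc.intervalIntegrable _ _)
      have ht0 : 0 ≤ t := by rw [Set.uIcc_of_le hy] at ht; exact ht.1
      rw [abs_of_nonneg ht0]
      have h : HasDerivAt (fun s : ℝ => (ε + s)⁻¹) (-1 / (ε + t) ^ 2) t :=
        ((hasDerivAt_id t).const_add ε).inv (add_pos_of_pos_of_nonneg hε ht0).ne'
      simpa [one_div, neg_div] using h
    simp only [k, this]
    ring
  obtain ⟨h1, hL⟩ := exists_contDiff_lipschitz_of_hasDerivAt hk hc (C := 1 / ε ^ 2) fun y => by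
    rw [abs_neg, abs_of_nonneg (by positivity)]
    gcongr
    linarith [abs_nonneg y]
  refine (hS.comp h1 hL).1.congr ?_
  filter_upwards [hS0] with ω hω using hk0 _ hω

theorem MemD.div_const_add {G S : Ω → ℝ} (hG : E.MemD G) {C : ℝ} (hC : ∀ᵐ ω ∂P, |G ω| ≤ C)
    (hS : E.MemD S) (hS0 : ∀ᵐ ω ∂P, 0 ≤ S ω) {ε : ℝ} (hε : 0 < ε) :
    E.MemD fun ω => G ω / (ε + S ω) := by
  have hb : ∀ᵐ ω ∂P, |1 / (ε + S ω)| ≤ 1 / ε := by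
    filter_upwards [hS0] with ω hω
    rw [abs_of_nonneg (by positivity)]
    gcongr
    linarith
  refine (hG.mul (hS.one_div_const_add hS0 hε) hC hb).1.congr
    (Eventually.of_forall fun ω => ?_)
  simp only [mul_one_div]

/-- The image under `X` of `Γ[X] / (1 + Γ[X]) P` is bounded by a multiple of Lebesgue measure,
and the law of `X` is absolutely continuous with respect to this image because the factor is
positive. -/
theorem HasGenerator.map_absolutelyContinuous (hXA : E.HasGenerator X AX) (hX : Measurable X)
    (hS : E.MemD (E.Γ X X)) (hpos : ∀ᵐ ω ∂P, 0 < E.Γ X X ω) : P.map X ≪ volume := by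
  have hS0 : ∀ᵐ ω ∂P, 0 ≤ E.Γ X X ω := hpos.mono fun _ h => h.le
  have h1 : ∀ᵐ ω : Ω ∂P, |(1 : ℝ)| ≤ 1 := Eventually.of_forall fun _ => by simp
  set W : Ω → ℝ := fun ω => 1 / (1 + E.Γ X X ω) with hWdef
  have hW : E.MemD W := hS.one_div_const_add hS0 one_pos
  have hWb : ∀ᵐ ω ∂P, |W ω| ≤ 1 / 1 := abs_div_const_add_le h1 hS0 one_pos
  have hZ : Integrable (fun ω => E.Γ X X ω * W ω) P :=
    (E.integrable_Γ X X).mul_bdd hW.memLp.aestronglyMeasurable hWb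
  have hZpos : ∀ᵐ ω ∂P, 0 < E.Γ X X ω * W ω := by
    filter_upwards [hpos] with ω hω
    positivity
  have hZm : AEMeasurable (fun ω => ENNReal.ofReal (E.Γ X X ω * W ω)) P :=
    hZ.aestronglyMeasurable.aemeasurable.ennreal_ofReal
  set Q : Measure Ω := P.withDensity fun ω => ENNReal.ofReal (E.Γ X X ω * W ω) with hQ
  have : IsFiniteMeasure Q := isFiniteMeasure_withDensity_ofReal hZ.2
  have hPQ : P ≪ Q := withDensity_absolutelyContinuous' hZm
    (hZpos.mono fun ω h => (ENNReal.ofReal_pos.2 h).ne')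
  have hK := hXA.integrable_ibpWeight hW hWb
  refine (hPQ.map hX).trans (absolutelyContinuous_of_integral_le
    (C := ∫ ω, |E.ibpWeight X AX W ω| ∂P) (integral_nonneg fun ω => abs_nonneg _)
    fun φ hφ hsupp hφ0 => ?_)
  rw [integral_map hX.aemeasurable hφ.aestronglyMeasurable, hQ,
    integral_withDensity_eq_integral_toReal_smul₀ hZm
      (Eventually.of_forall fun _ => ENNReal.ofReal_lt_top)]
  have hi : Integrable φ := hφ.integrable_of_hasCompactSupport hsupp
  calc ∫ ω, (ENNReal.ofReal (E.Γ X X ω * W ω)).toReal • φ (X ω) ∂P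
      = ∫ ω, φ (X ω) * (E.Γ X X ω * W ω) ∂P := by
        refine integral_congr_ae ?_
        filter_upwards [hZpos] with ω hω
        rw [ENNReal.toReal_ofReal hω.le, smul_eq_mul, mul_comm]
    _ = ∫ x, φ x * signMean P X (E.ibpWeight X AX W) x :=
        hXA.integral_comp_mul hX hW hWb hφ hsupp
    _ ≤ ∫ x, φ x * ∫ ω, |E.ibpWeight X AX W ω| ∂P := by
        refine integral_mono (hi.mul_bdd (aestronglyMeasurable_signMean hX hK)
          (Eventually.of_forall fun x => abs_signMean_le hX hK x)) (hi.mul_const _) fun x => ?_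
        exact mul_le_mul_of_nonneg_left ((le_abs_self _).trans (abs_signMean_le hX hK x)) (hφ0 x)
    _ = _ := by rw [integral_mul_const, mul_comm]

/-- Both sides are densities of the image under `X` of the signed measure `Γ[X] W P`. -/
theorem HasGenerator.signMean_ae_eq (hXA : E.HasGenerator X AX) (hX : Measurable X)
    {W Z : Ω → ℝ} (hW : E.MemD W) {C : ℝ} (hC : ∀ᵐ ω ∂P, |W ω| ≤ C)
    (hZ : ∀ᵐ ω ∂P, E.Γ X X ω * W ω = Z ω) {f m : ℝ → ℝ} (hf : IsDensityOf P X f)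
    (hm : IsCondExpGiven P X Z m) :
    ∀ᵐ x, signMean P X (E.ibpWeight X AX W) x = f x * m x := by
  have hZi : Integrable Z P :=
    ((E.integrable_Γ X X).mul_bdd hW.memLp.aestronglyMeasurable hC).congr hZ
  refine ae_eq_of_integral_contDiff_smul_eq
    (locallyIntegrable_signMean hX (hXA.integrable_ibpWeight hW hC))
    (hf.integrable_mul hX hm).locallyIntegrable fun φ hφ hsupp => ?_
  obtain ⟨B, hB⟩ := hsupp.exists_bound_of_continuous hφ.continuous
  simp only [smul_eq_mul]
  rw [← hXA.integral_comp_mul hX hW hC hφ.continuous hsupp,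
    ← hf.integral_mul_comp hX hZi hm hφ.continuous.measurable hB]
  refine integral_congr_ae ?_
  filter_upwards [hZ] with ω hω
  rw [hω]

/-! ### Regularised densities -/

/-- The regularised density `x ↦ (1/2) E[sign(x - X) (Γ[X, W] + 2 W A[X])]`, where
`W = G / (ε + Γ[X])`. -/
noncomputable def regDensity (E : ErrorStructure P) (X AX G : Ω → ℝ) (ε x : ℝ) : ℝ :=
  signMean P X (E.ibpWeight X AX fun ω => G ω / (ε + E.Γ X X ω)) x

variable {G : Ω → ℝ} {C : ℝ}

theorem HasGenerator.continuous_regDensity (hXA : E.HasGenerator X AX) (hX : Measurable X)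
    (hS : E.MemD (E.Γ X X)) (hpos : ∀ᵐ ω ∂P, 0 < E.Γ X X ω) (hG : E.MemD G)
    (hC : ∀ᵐ ω ∂P, |G ω| ≤ C) {ε : ℝ} (hε : 0 < ε) :
    Continuous (E.regDensity X AX G ε) := by
  have hS0 : ∀ᵐ ω ∂P, 0 ≤ E.Γ X X ω := hpos.mono fun _ h => h.le
  exact continuous_signMean hX (hXA.integrable_ibpWeight (hG.div_const_add hC hS hS0 hε)
    (abs_div_const_add_le hC hS0 hε)) (hXA.map_absolutelyContinuous hX hS hpos)

theorem HasGenerator.regDensity_ae_eq (hXA : E.HasGenerator X AX) (hX : Measurable X)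
    (hS : E.MemD (E.Γ X X)) (hS0 : ∀ᵐ ω ∂P, 0 ≤ E.Γ X X ω) (hG : E.MemD G)
    (hC : ∀ᵐ ω ∂P, |G ω| ≤ C) {ε : ℝ} (hε : 0 < ε) {f m : ℝ → ℝ} (hf : IsDensityOf P X f)
    (hm : IsCondExpGiven P X (fun ω => E.Γ X X ω * (G ω / (ε + E.Γ X X ω))) m) :
    ∀ᵐ x, E.regDensity X AX G ε x = f x * m x :=
  hXA.signMean_ae_eq hX (hG.div_const_add hC hS hS0 hε) (abs_div_const_add_le hC hS0 hε)
    (Eventually.of_forall fun _ => rfl) hf hm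

theorem integrable_Γ_mul_div (E : ErrorStructure P) (hG : E.MemD G) (hC : ∀ᵐ ω ∂P, |G ω| ≤ C)
    (hS : E.MemD (E.Γ X X)) (hS0 : ∀ᵐ ω ∂P, 0 ≤ E.Γ X X ω) {ε : ℝ} (hε : 0 < ε) :
    Integrable (fun ω => E.Γ X X ω * (G ω / (ε + E.Γ X X ω))) P :=
  (E.integrable_Γ X X).mul_bdd (hG.div_const_add hC hS hS0 hε).memLp.aestronglyMeasurable
    (abs_div_const_add_le hC hS0 hε)

theorem HasGenerator.regDensity_antitone (hXA : E.HasGenerator X AX) (hX : Measurable X)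
    (hS : E.MemD (E.Γ X X)) (hpos : ∀ᵐ ω ∂P, 0 < E.Γ X X ω) (hG : E.MemD G)
    (hC : ∀ᵐ ω ∂P, |G ω| ≤ C) (hG0 : ∀ᵐ ω ∂P, 0 ≤ G ω) {ε δ : ℝ} (hε : 0 < ε) (hεδ : ε ≤ δ)
    (x : ℝ) : E.regDensity X AX G δ x ≤ E.regDensity X AX G ε x := by
  have hS0 : ∀ᵐ ω ∂P, 0 ≤ E.Γ X X ω := hpos.mono fun _ h => h.le
  have hδ := hε.trans_le hεδ
  refine (hXA.continuous_regDensity hX hS hpos hG hC hδ).le_of_ae_le_volume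
    (hXA.continuous_regDensity hX hS hpos hG hC hε) ?_ x
  obtain ⟨f, hf⟩ := exists_isDensityOf hX (hXA.map_absolutelyContinuous hX hS hpos)
  obtain ⟨m, hm⟩ := exists_isCondExpGiven P X fun ω => E.Γ X X ω * (G ω / (ε + E.Γ X X ω))
  obtain ⟨m', hm'⟩ := exists_isCondExpGiven P X fun ω => E.Γ X X ω * (G ω / (δ + E.Γ X X ω))
  filter_upwards [hXA.regDensity_ae_eq hX hS hS0 hG hC hε hf hm,
    hXA.regDensity_ae_eq hX hS hS0 hG hC hδ hf hm',
    hf.mul_le_mul hX (E.integrable_Γ_mul_div hG hC hS hS0 hδ)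
      (E.integrable_Γ_mul_div hG hC hS hS0 hε) hm' hm (by
        filter_upwards [hpos, hG0] with ω h1 h2
        gcongr)] with x h1 h2 h3
  rwa [h1, h2]

theorem HasGenerator.tendsto_regDensity (hXA : E.HasGenerator X AX) (hX : Measurable X)
    (hS : E.MemD (E.Γ X X)) (hpos : ∀ᵐ ω ∂P, 0 < E.Γ X X ω) (hG : E.MemD G)
    (hC : ∀ᵐ ω ∂P, |G ω| ≤ C) (hG0 : ∀ᵐ ω ∂P, 0 ≤ G ω) (x : ℝ) :
    Tendsto (fun ε => (E.regDensity X AX G ε x : EReal)) (𝓝[>] 0)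
      (𝓝 (⨆ ε ∈ Set.Ioi (0 : ℝ), (E.regDensity X AX G ε x : EReal))) := by
  rw [← sSup_image]
  refine AntitoneOn.tendsto_nhdsGT (fun ε hε δ hδ hεδ => ?_) (OrderTop.bddAbove _)
  exact EReal.coe_le_coe_iff.2 (hXA.regDensity_antitone hX hS hpos hG hC hG0 hε hεδ x)

theorem HasGenerator.lowerSemicontinuous_iSup_regDensity (hXA : E.HasGenerator X AX)
    (hX : Measurable X) (hS : E.MemD (E.Γ X X)) (hpos : ∀ᵐ ω ∂P, 0 < E.Γ X X ω) (hG : E.MemD G)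
    (hC : ∀ᵐ ω ∂P, |G ω| ≤ C) :
    LowerSemicontinuous fun x => ⨆ ε ∈ Set.Ioi (0 : ℝ), (E.regDensity X AX G ε x : EReal) :=
  lowerSemicontinuous_biSup fun _ hε => (continuous_coe_real_ereal.comp
    (hXA.continuous_regDensity hX hS hpos hG hC hε)).lowerSemicontinuous

/-- Along `ε = 1 / (n + 1)` the regularised densities increase, are bounded by `f g`, and their
integrals converge to that of `f g`; monotonicity in `ε` passes from the sequence to the full
limit, so that a single null set serves for all `ε`. -/
theorem HasGenerator.tendsto_regDensity_ae_of_nonneg (hXA : E.HasGenerator X AX)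
    (hX : Measurable X) (hS : E.MemD (E.Γ X X)) (hpos : ∀ᵐ ω ∂P, 0 < E.Γ X X ω) (hG : E.MemD G)
    (hC : ∀ᵐ ω ∂P, |G ω| ≤ C) (hG0 : ∀ᵐ ω ∂P, 0 ≤ G ω) {f g : ℝ → ℝ} (hf : IsDensityOf P X f)
    (hg : IsCondExpGiven P X G g) :
    ∀ᵐ x, Tendsto (fun ε => E.regDensity X AX G ε x) (𝓝[>] 0) (𝓝 (f x * g x)) := by
  have hS0 : ∀ᵐ ω ∂P, 0 ≤ E.Γ X X ω := hpos.mono fun _ h => h.le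
  have hGi : Integrable G P := hG.memLp.integrable (by norm_num)
  let e : ℕ → ℝ := fun n => 1 / ((n : ℝ) + 1)
  have he : ∀ n, 0 < e n := fun n => by positivity
  have he0 : Tendsto e atTop (𝓝 0) := tendsto_one_div_add_atTop_nhds_zero_nat
  choose m hm using fun n => exists_isCondExpGiven P X
    fun ω => E.Γ X X ω * (G ω / (e n + E.Γ X X ω))
  have heq := fun n => hXA.regDensity_ae_eq hX hS hS0 hG hC (he n) hf (hm n)
  have hZi := fun n => E.integrable_Γ_mul_div hG hC hS hS0 (he n)
  have hZle : ∀ n, ∀ᵐ ω ∂P, E.Γ X X ω * (G ω / (e n + E.Γ X X ω)) ≤ G ω := fun n => by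
    filter_upwards [hpos, hG0] with ω h1 h2
    rw [mul_div_left_comm]
    exact mul_le_of_le_one_right h2 ((div_le_one (by linarith [he n])).2 (by linarith [he n]))
  have hlim : Tendsto (fun n => ∫ x, E.regDensity X AX G (e n) x) atTop
      (𝓝 (∫ x, f x * g x)) := by
    simp only [fun n => integral_congr_ae (heq n), fun n => hf.integral_mul hX (hZi n) (hm n),
      hf.integral_mul hX hGi hg]
    refine tendsto_integral_of_dominated_convergence (fun ω => |G ω|)
      (fun n => (hZi n).aestronglyMeasurable) hGi.abs (fun n => ?_) ?_
    · filter_upwards [hZle n, hpos, hG0] with ω h1 h2 h3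
      have := he n
      rw [Real.norm_eq_abs, abs_of_nonneg (by positivity)]
      exact h1.trans (le_abs_self _)
    · filter_upwards [hpos] with ω h1
      have h2 : Tendsto (fun n => E.Γ X X ω * (G ω / (e n + E.Γ X X ω))) atTop
          (𝓝 (E.Γ X X ω * (G ω / (0 + E.Γ X X ω)))) :=
        (tendsto_const_nhds.div (he0.add_const _) (by simpa using h1.ne')).const_mul _
      rwa [zero_add, mul_div_cancel₀ _ h1.ne'] at h2
  have hmono : ∀ x, Monotone fun n => E.regDensity X AX G (e n) x := fun x n k hnk =>
    hXA.regDensity_antitone hX hS hpos hG hC hG0 (he k) (Nat.one_div_le_one_div hnk) x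
  have hle : ∀ᵐ x, ∀ n, E.regDensity X AX G (e n) x ≤ f x * g x := by
    refine ae_all_iff.2 fun n => ?_
    filter_upwards [heq n, hf.mul_le_mul hX (hZi n) hGi (hm n) hg (hZle n)] with x h1 h2
    rwa [h1]
  filter_upwards [tendsto_of_integral_tendsto_of_monotone
    (fun n => (integrable_congr (heq n)).2 (hf.integrable_mul hX (hm n)))
    (hf.integrable_mul hX hg) hlim (Eventually.of_forall hmono) hle] with x hx
  have hsup := hXA.tendsto_regDensity hX hS hpos hG hC hG0 x
  have he0' : Tendsto e atTop (𝓝[>] 0) :=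
    tendsto_nhdsWithin_iff.2 ⟨he0, Eventually.of_forall he⟩
  rw [tendsto_nhds_unique (hsup.comp he0') (EReal.tendsto_coe.2 hx)] at hsup
  exact EReal.tendsto_coe.1 hsup

theorem HasGenerator.regDensity_add (hXA : E.HasGenerator X AX) (hX : Measurable X)
    (hS : E.MemD (E.Γ X X)) (hS0 : ∀ᵐ ω ∂P, 0 ≤ E.Γ X X ω) {H : Ω → ℝ} {D : ℝ} (hG : E.MemD G)
    (hC : ∀ᵐ ω ∂P, |G ω| ≤ C) (hH : E.MemD H) (hD : ∀ᵐ ω ∂P, |H ω| ≤ D) {ε : ℝ} (hε : 0 < ε)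
    (x : ℝ) : E.regDensity X AX (fun ω => G ω + H ω) ε x =
      E.regDensity X AX G ε x + E.regDensity X AX H ε x := by
  have hWG := hG.div_const_add hC hS hS0 hε
  have hWH := hH.div_const_add hD hS hS0 hε
  simp only [regDensity, signMean]
  rw [← mul_add, ← integral_add
    (integrable_sign_mul hX (hXA.integrable_ibpWeight hWG (abs_div_const_add_le hC hS0 hε)) x)
    (integrable_sign_mul hX (hXA.integrable_ibpWeight hWH (abs_div_const_add_le hD hS0 hε)) x)]
  congr 1
  refine integral_congr_ae ?_
  have h := Γ_add_right hXA.1 hWG hWH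
  simp only [← add_div] at h
  filter_upwards [h] with ω h1
  simp only [ibpWeight, h1]
  ring

/-- The general case follows by linearity from the nonnegative functions `G + C` and `C`. -/
theorem HasGenerator.tendsto_regDensity_ae (hXA : E.HasGenerator X AX)
    (hX : Measurable X) (hS : E.MemD (E.Γ X X)) (hpos : ∀ᵐ ω ∂P, 0 < E.Γ X X ω) (hG : E.MemD G)
    (hC : ∀ᵐ ω ∂P, |G ω| ≤ C) {f g : ℝ → ℝ} (hf : IsDensityOf P X f)
    (hg : IsCondExpGiven P X G g) :
    ∀ᵐ x, Tendsto (fun ε => E.regDensity X AX G ε x) (𝓝[>] 0) (𝓝 (f x * g x)) := by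
  have hS0 : ∀ᵐ ω ∂P, 0 ≤ E.Γ X X ω := hpos.mono fun _ h => h.le
  have hC0 : 0 ≤ C := by
    obtain ⟨ω, hω⟩ := hC.exists
    exact (abs_nonneg _).trans hω
  have hcD : E.MemD fun _ => C := MemD.const E C
  have hcb : ∀ᵐ ω : Ω ∂P, |C| ≤ C := Eventually.of_forall fun _ => (abs_of_nonneg hC0).le
  have hc : IsCondExpGiven P X (fun _ => C) fun _ => C :=
    ⟨measurable_const, by rw [condExp_const hX.comap_le]⟩
  have hgc : IsCondExpGiven P X (fun ω => G ω + C) fun x => g x + C := by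
    refine ⟨hg.1.add_const C, ?_⟩
    filter_upwards [hg.2, condExp_add (hG.memLp.integrable (by norm_num)) (integrable_const C)
      (MeasurableSpace.comap X inferInstance)] with ω h1 h2
    rw [condExp_const hX.comap_le] at h2
    change g (X ω) + C = (P[G + fun _ => C | MeasurableSpace.comap X inferInstance]) ω
    rw [h2, h1]
    rfl
  have hGcb : ∀ᵐ ω ∂P, |G ω + C| ≤ C + C := by
    filter_upwards [hC] with ω h
    exact (abs_add_le _ _).trans (add_le_add h (abs_of_nonneg hC0).le)
  filter_upwards [hXA.tendsto_regDensity_ae_of_nonneg hX hS hpos (hG.add hcD) hGcb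
      (hC.mono fun ω h => by linarith [(abs_le.1 h).1]) hf hgc,
    hXA.tendsto_regDensity_ae_of_nonneg hX hS hpos hcD hcb
      (Eventually.of_forall fun _ => hC0) hf hc] with x h1 h2
  have h3 := h1.sub h2
  rw [← mul_sub, add_sub_cancel_right] at h3
  refine h3.congr' ?_
  filter_upwards [self_mem_nhdsWithin] with ε hε
  rw [hXA.regDensity_add hX hS hS0 hG hC hcD hcb hε, add_sub_cancel_right]

end ErrorStructure

/-! ### Densities and conditional expectations by integration by parts -/

theorem MeasureTheory.MemLp.exists_ae_abs_le {Ω : Type*} [MeasurableSpace Ω] {P : Measure Ω}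
    {G : Ω → ℝ} (hG : MemLp G ⊤ P) : ∃ C, ∀ᵐ ω ∂P, |G ω| ≤ C := by
  refine ⟨(eLpNorm G ⊤ P).toReal, ?_⟩
  filter_upwards [ae_le_eLpNormEssSup (f := G) (μ := P)] with ω hω
  rw [← eLpNorm_exponent_top] at hω
  simpa using ENNReal.toReal_mono hG.2.ne hω

theorem proposition5 {Ω : Type*} [MeasurableSpace Ω] (P : Measure Ω) [IsProbabilityMeasure P]
    (E : ErrorStructure P) (X AX G : Ω → ℝ)
    (hXm : Measurable X)
    (hXA : E.HasGenerator X AX)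
    (hΓD : E.MemD (E.Γ X X))
    (hΓpos : ∀ᵐ ω ∂P, 0 < E.Γ X X ω)
    (hGD : E.MemD G) (hGb : MemLp G ⊤ P) :
    -- the law of `X` has a density
    (∃ f : ℝ → ℝ, IsDensityOf P X f) ∧
    -- a) the terms under the expectation are well defined and integrable
    (∀ ε : ℝ, 0 < ε →
      E.MemD (fun ω => G ω / (ε + E.Γ X X ω)) ∧
      Integrable (fun ω => E.Γ X (fun ω' => G ω' / (ε + E.Γ X X ω')) ω
        + 2 * G ω * AX ω / (ε + E.Γ X X ω)) P) ∧
    -- a) the formula, almost everywhere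
    (∀ f g : ℝ → ℝ, IsDensityOf P X f → IsCondExpGiven P X G g →
      ∀ᵐ x : ℝ, Tendsto (fun ε : ℝ =>
        1 / 2 * ∫ ω, Real.sign (x - X ω) *
          (E.Γ X (fun ω' => G ω' / (ε + E.Γ X X ω')) ω
            + 2 * G ω * AX ω / (ε + E.Γ X X ω)) ∂P)
        (𝓝[>] 0) (𝓝 (f x * g x))) ∧
    -- a) if `G ≥ 0`, the limit exists in `[-∞, ∞]` at every `x` and is l.s.c. in `x`
    ((∀ᵐ ω ∂P, 0 ≤ G ω) →
      ∃ R : ℝ → EReal, LowerSemicontinuous R ∧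
        ∀ x : ℝ, Tendsto (fun ε : ℝ =>
          ((1 / 2 * ∫ ω, Real.sign (x - X ω) *
            (E.Γ X (fun ω' => G ω' / (ε + E.Γ X X ω')) ω
              + 2 * G ω * AX ω / (ε + E.Γ X X ω)) ∂P : ℝ) : EReal))
          (𝓝[>] 0) (𝓝 (R x))) ∧
    -- b)
    (E.MemD (fun ω => 1 / E.Γ X X ω) → MemLp (fun ω => 1 / E.Γ X X ω) ⊤ P →
      E.MemD (fun ω => G ω / E.Γ X X ω) ∧
      Integrable (fun ω => E.Γ X (fun ω' => G ω' / E.Γ X X ω') ω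
        + 2 * G ω * AX ω / E.Γ X X ω) P ∧
      (∀ f g : ℝ → ℝ, IsDensityOf P X f → IsCondExpGiven P X G g →
        ∀ᵐ x : ℝ, f x * g x =
          1 / 2 * ∫ ω, Real.sign (x - X ω) *
            (E.Γ X (fun ω' => G ω' / E.Γ X X ω') ω
              + 2 * G ω * AX ω / E.Γ X X ω) ∂P) ∧
      Continuous (fun x : ℝ =>
        1 / 2 * ∫ ω, Real.sign (x - X ω) *
          (E.Γ X (fun ω' => G ω' / E.Γ X X ω') ω
            + 2 * G ω * AX ω / E.Γ X X ω) ∂P)) := by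
  obtain ⟨C, hC⟩ := hGb.exists_ae_abs_le
  have hS0 : ∀ᵐ ω ∂P, 0 ≤ E.Γ X X ω := hΓpos.mono fun _ h => h.le
  have hac := hXA.map_absolutelyContinuous hXm hΓD hΓpos
  have hW : ∀ W : Ω → ℝ, (∀ d : Ω → ℝ, W = (fun ω => G ω / d ω) →
      (fun ω => E.Γ X W ω + 2 * G ω * AX ω / d ω) = E.ibpWeight X AX W) := by
    rintro W d rfl
    funext ω
    simp only [ErrorStructure.ibpWeight]
    ring
  have hreg : ∀ ε x : ℝ, 1 / 2 * ∫ ω, Real.sign (x - X ω) *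
      (E.Γ X (fun ω' => G ω' / (ε + E.Γ X X ω')) ω
        + 2 * G ω * AX ω / (ε + E.Γ X X ω)) ∂P = E.regDensity X AX G ε x := fun ε x => by
    rw [ErrorStructure.regDensity, ← hW _ (fun ω => ε + E.Γ X X ω) rfl, signMean]
  simp only [hreg]
  refine ⟨exists_isDensityOf hXm hac, fun ε hε => ?_,
    fun f g hf hg => hXA.tendsto_regDensity_ae hXm hΓD hΓpos hGD hC hf hg,
    fun hG0 => ⟨_, hXA.lowerSemicontinuous_iSup_regDensity hXm hΓD hΓpos hGD hC,
      hXA.tendsto_regDensity hXm hΓD hΓpos hGD hC hG0⟩, fun hinvD hinvb => ?_⟩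
  · have hD := hGD.div_const_add hC hΓD hS0 hε
    refine ⟨hD, ?_⟩
    rw [hW _ (fun ω => ε + E.Γ X X ω) rfl]
    exact hXA.integrable_ibpWeight hD (abs_div_const_add_le hC hS0 hε)
  · obtain ⟨B, hB⟩ := hinvb.exists_ae_abs_le
    have hD : E.MemD fun ω => G ω / E.Γ X X ω := by
      simpa only [mul_one_div] using (hGD.mul hinvD hC hB).1
    have hb : ∀ᵐ ω ∂P, |G ω / E.Γ X X ω| ≤ C * B := by
      filter_upwards [hC, hB] with ω h1 h2
      rw [← mul_one_div, abs_mul]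
      exact mul_le_mul h1 h2 (abs_nonneg _) ((abs_nonneg _).trans h1)
    have hK := hW _ (E.Γ X X) rfl
    have hsign : ∀ x : ℝ, 1 / 2 * ∫ ω, Real.sign (x - X ω) *
        (E.Γ X (fun ω' => G ω' / E.Γ X X ω') ω + 2 * G ω * AX ω / E.Γ X X ω) ∂P =
        signMean P X (E.ibpWeight X AX fun ω => G ω / E.Γ X X ω) x := fun x => by
      rw [← hK, signMean]
    have hi := hXA.integrable_ibpWeight hD hb
    simp only [hsign]
    refine ⟨hD, hK ▸ hi, fun f g hf hg => ?_, continuous_signMean hXm hi hac⟩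
    filter_upwards [hXA.signMean_ae_eq hXm hD hb
      (hΓpos.mono fun ω h => mul_div_cancel₀ (G ω) h.ne') hf hg] with x hx using hx.symm
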